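/- Let $X$ be a real Banach space which admits a $C^1$ Lipschitz bump function, i.e. a $C^1$ smooth, Lipschitz function $b\colon X\to\mathbb R$ whose support $\overline{\{b\neq 0\}}$ is bounded and non-empty. Let $M$ be a connected, paracompact (Hausdorff) $C^1$ Banach manifold modeled on $X$, equipped with a $C^1$ Finsler structure in the sense of Palais, i.e. a continuous map $\|\cdot\|_M\colon TM\to[0,\infty)$ such that (P1) for every $x\in M$ the restriction $\|\cdot\|_x$ of $\|\cdot\|_M$ to $T_xM$ is a norm, and for every chart $\varphi\colon U\to X$ with $x\in U$ the norm $v\mapsto\|d\varphi^{-1}(\varphi(x))(v)\|_x$ on $X$ is equivalent to the norm of $X$; (P2) for every $x_0\in M$, every $\varepsilon>0$ and every chart $\varphi\colon U\to X$ with $x_0\in U$ there is an open neighborhood $W\subset U$ of $x_0$ such that for all $x\in W$ and $v\in X$ $$\frac{1}{1+\varepsilon}\,\|d\varphi^{-1}(\varphi(x_0))(v)\|_{x_0}\le\|d\varphi^{-1}(\varphi(x))(v)\|_x\le(1+\varepsilon)\,\|d\varphi^{-1}(\varphi(x_0))(v)\|_{x_0}.$$ For $p,q\in M$ let $d(p,q)$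 be the infimum of the lengths $\ell(c)=\int_a^b\|c'(t)\|_{c(t)}\,dt$ over all piecewise $C^1$ smooth paths $c\colon[a,b]\to M$ from $p$ to $q$ (the Finsler metric). For $f\colon M\to\mathbb R$ and $x\in M$ let $$D^-f(x)=\{dg(x) : g\colon M\to\mathbb R \text{ is } C^1 \text{ smooth and } f-g \text{ attains a local minimum at } x\}\subset T_xM^*,$$ and for $\xi\in T_xM^*$ let $\|\xi\|_x=\sup\{|\xi(v)| : v\in T_xM,\ \|v\|_x=1\}$ be the dual norm (equal to $0$ if $T_xM=0$). Let $f\colon M\to\mathbb R$ be lower semicontinuous and let $K\in\mathbb R$ be such that $\|\xi\|_x\le K$ for every $x\in M$ and every $\xi\in D^-f(x)$. Then $f$ is $K$-Lipschitz for the Finsler metric, that is, $K\ge 0$ and $|f(y)-f(z)|\le K\,d(y,z)$ for all $y,z\in M$. -/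

import Mathlib

open Set Filter Topology
open scoped Manifold ContDiff

noncomputable section

namespace PalaisFinsler

/-- `X` admits a `C^1` Lipschitz bump function: a `C^1` smooth Lipschitz function `b : X → ℝ`
whose support (the closure of `{b ≠ 0}`) is bounded and nonempty. -/
def HasC1LipschitzBump (X : Type*) [NormedAddCommGroup X] [NormedSpace ℝ X] : Prop :=
  ∃ b : X → ℝ, ContDiff ℝ 1 b ∧ (∃ C : NNReal, LipschitzWith C b) ∧
    Bornology.IsBounded (tsupport b) ∧ (tsupport b).Nonempty

section Basic

variable {X : Type*} [NormedAddCommGroup X] [NormedSpace ℝ X]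
  {M : Type*} [TopologicalSpace M] [ChartedSpace X M]

/-- The norm `‖dφ⁻¹(φ(x))(v)‖_x` on `X` induced through a chart `φ` by the norm of `T_xM`, for `x`
in the domain of `φ`. (The foot point is written as `φ⁻¹(φ(x))`, which is `x`.) -/
def chartNorm (nrm : (x : M) → TangentSpace 𝓘(ℝ, X) x → ℝ) (φ : OpenPartialHomeomorph M X)
    (x : M) (v : X) : ℝ :=
  nrm (φ.symm (φ x)) (mfderiv 𝓘(ℝ, X) 𝓘(ℝ, X) φ.symm (φ x) v)

variable (X M) in
/-- A `C^1` Finsler structure in the sense of Palais on the `C^1` manifold `M` modeled on `X`: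
a continuous function on the tangent bundle which is a norm on each tangent space and satisfies
the conditions (P1) `equiv` and (P2) `palais` in all charts of the maximal `C^1` atlas. -/
structure FinslerStructure [IsManifold 𝓘(ℝ, X) 1 M] where
  /-- The norm `‖v‖_x` of a tangent vector `v ∈ T_xM`. -/
  nrm : (x : M) → TangentSpace 𝓘(ℝ, X) x → ℝ
  continuous_nrm : Continuous fun v : TangentBundle 𝓘(ℝ, X) M => nrm v.proj v.snd
  nonneg : ∀ (x : M) (v : TangentSpace 𝓘(ℝ, X) x), 0 ≤ nrm x v
  eq_zero : ∀ (x : M) (v : TangentSpace 𝓘(ℝ, X) x), nrm x v = 0 → v = 0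
  smul : ∀ (x : M) (r : ℝ) (v : TangentSpace 𝓘(ℝ, X) x), nrm x (r • v) = |r| * nrm x v
  add_le : ∀ (x : M) (v w : TangentSpace 𝓘(ℝ, X) x), nrm x (v + w) ≤ nrm x v + nrm x w
  equiv : ∀ φ ∈ IsManifold.maximalAtlas 𝓘(ℝ, X) 1 M, ∀ x ∈ φ.source,
    ∃ C : ℝ, 1 ≤ C ∧ ∀ v : X,
      C⁻¹ * ‖v‖ ≤ chartNorm nrm φ x v ∧ chartNorm nrm φ x v ≤ C * ‖v‖
  palais : ∀ φ ∈ IsManifold.maximalAtlas 𝓘(ℝ, X) 1 M, ∀ x₀ ∈ φ.source,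
    ∀ ε : ℝ, 0 < ε → ∃ W : Set M, IsOpen W ∧ x₀ ∈ W ∧ W ⊆ φ.source ∧ ∀ x ∈ W, ∀ v : X,
      (1 + ε)⁻¹ * chartNorm nrm φ x₀ v ≤ chartNorm nrm φ x v ∧
      chartNorm nrm φ x v ≤ (1 + ε) * chartNorm nrm φ x₀ v

variable (X) in
/-- `c`, restricted to `[a, b]`, is a (continuous) piecewise `C^1` smooth path in `M`: there is
a subdivision `a = t 0 ≤ t 1 ≤ ⋯ ≤ t n = b` such that `c` is `C^1` on each `[t i, t (i + 1)]`. -/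
def IsPiecewiseC1 (c : ℝ → M) (a b : ℝ) : Prop :=
  ContinuousOn c (Icc a b) ∧ ∃ (n : ℕ) (t : ℕ → ℝ), Monotone t ∧ t 0 = a ∧ t n = b ∧
    ∀ i < n, ContMDiffOn 𝓘(ℝ, ℝ) 𝓘(ℝ, X) 1 c (Icc (t i) (t (i + 1)))

variable (X) in
/-- The set of subdifferentials `D⁻f(x) ⊆ T_xM*` of `f : M → ℝ` at `x`: all differentials `dg(x)`
of `C^1` smooth functions `g : M → ℝ` such that `f - g` attains a local minimum at `x`. -/
def subdifferential (f : M → ℝ) (x : M) : Set (TangentSpace 𝓘(ℝ, X) x →L[ℝ] ℝ) :=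
  {Δ | ∃ g : M → ℝ, ContMDiff 𝓘(ℝ, X) 𝓘(ℝ, ℝ) 1 g ∧ IsLocalMin (fun y => f y - g y) x ∧
    Δ = mfderiv 𝓘(ℝ, X) 𝓘(ℝ, ℝ) g x}

namespace FinslerStructure

variable [IsManifold 𝓘(ℝ, X) 1 M] (F : FinslerStructure X M)

/-- The dual norm `‖Δ‖_x = sup {|Δ(ξ)| : ξ ∈ T_xM, ‖ξ‖_x = 1}` on `T_xM*`
(equal to `0` if `T_xM = 0`). -/
def dualNorm (x : M) (Δ : TangentSpace 𝓘(ℝ, X) x →L[ℝ] ℝ) : ℝ :=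
  sSup {s : ℝ | ∃ ξ : TangentSpace 𝓘(ℝ, X) x, F.nrm x ξ = 1 ∧ s = |Δ ξ|}

/-- The length `∫ₐᵇ ‖c'(t)‖_{c(t)} dt` of a piecewise `C^1` path `c` on `[a, b]` (the velocity
exists at all but finitely many `t`). -/
def length (c : ℝ → M) (a b : ℝ) : ℝ :=
  ∫ t in a..b, F.nrm (c t) (mfderiv 𝓘(ℝ, ℝ) 𝓘(ℝ, X) c t (1 : ℝ))

/-- The Finsler metric: the infimum of the lengths of piecewise `C^1` paths from `p` to `q`. -/
def dist (p q : M) : ℝ :=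
  sInf {L : ℝ | ∃ (a b : ℝ) (c : ℝ → M), a ≤ b ∧ IsPiecewiseC1 X c a b ∧ c a = p ∧ c b = q ∧
    L = F.length c a b}

/-- `f` is `K`-Lipschitz (with `K ≥ 0`) for the Finsler metric. -/
def IsLipschitz (K : ℝ) (f : M → ℝ) : Prop :=
  0 ≤ K ∧ ∀ p q : M, |f p - f q| ≤ K * F.dist p q

end FinslerStructure

end Basic

end PalaisFinsler

end

/-! The heart is a mean value inequality in `X`: if every differential of a `C^1` function touching
`f` from below is at most `C` in the direction `y - x`, then `f y - f x ≤ C`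
(`HasC1LipschitzBump.sub_le_of_subdifferential`). It comes from minimizing `f` plus a penalty that
ties the point to the segment from `x` to `y` and rewards progress along it. In infinite dimension a
minimum exists only after a small `C^1` perturbation, which `IsUnitBump.exists_perturbation` builds
from rescaled bumps.

In a chart around a point, (P2) makes the Finsler norms at nearby points comparable up to a factor
`1 + ε`, so the inequality makes `f` almost `K`-Lipschitz for the norm at that point
(`FinslerStructure.eventually_abs_sub_le`). Functions touching `f` in the chart are cut off to
functions on `M`; this uses regularity of `M`, which follows from paracompactness and Hausdorffness.
Along a `C^1` path the local estimate bounds the right slopes of `f ∘ c` by `K` times the speed.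
Integrating gives `K` times the length, and the infimum over paths finishes the proof. -/

namespace PalaisFinsler

/-! ### Bumps, the smooth variational principle and the mean value inequality in Banach spaces -/

section BanachSpace

variable {X : Type*} [NormedAddCommGroup X] [NormedSpace ℝ X]

/-- A `C^1` function with bounded values and derivative, equal to `1` at the origin and vanishing
off the open unit ball. -/
structure IsUnitBump (b : X → ℝ) (S : ℝ) : Prop where
  one_le : 1 ≤ S
  contDiff : ContDiff ℝ 1 b
  map_zero : b 0 = 1
  eq_zero : ∀ x, 1 ≤ ‖x‖ → b x = 0
  abs_le : ∀ x, |b x| ≤ S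
  norm_fderiv_le : ∀ x, ‖fderiv ℝ b x‖ ≤ S

theorem HasC1LipschitzBump.exists_isUnitBump (hX : HasC1LipschitzBump X) :
    ∃ (b : X → ℝ) (S : ℝ), IsUnitBump b S := by
  obtain ⟨b, hb, ⟨C, hC⟩, hbd, hne⟩ := hX
  obtain ⟨x₀, hx₀⟩ : ∃ x₀, b x₀ ≠ 0 := by
    by_contra! h
    have : b = 0 := funext h
    simp [this, tsupport] at hne
  obtain ⟨ρ, hρ, hsub⟩ := hbd.subset_ball_lt 0 x₀
  have hcd : ContDiff ℝ 1 fun x => b (x₀ + ρ • x) / b x₀ := by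
    have : ContDiff ℝ 1 fun x : X => x₀ + ρ • x := by fun_prop
    exact (hb.comp this).div_const _
  have hz : ∀ x : X, 1 ≤ ‖x‖ → b (x₀ + ρ • x) / b x₀ = 0 := by
    intro x hx
    have : x₀ + ρ • x ∉ tsupport b := by
      intro h
      have := hsub h
      rw [Metric.mem_ball, dist_eq_norm, add_sub_cancel_left, norm_smul, Real.norm_eq_abs,
        abs_of_pos hρ] at this
      nlinarith
    rw [image_eq_zero_of_notMem_tsupport this, zero_div]
  have hlip : LipschitzWith (‖(b x₀)⁻¹‖₊ * (C * ‖ρ‖₊)) fun x : X => b (x₀ + ρ • x) / b x₀ := by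
    refine LipschitzWith.of_dist_le_mul fun x y => ?_
    have h := hC.dist_le_mul (x₀ + ρ • x) (x₀ + ρ • y)
    rw [dist_add_left, dist_smul₀] at h
    rw [Real.dist_eq, ← sub_div, div_eq_inv_mul, abs_mul, ← Real.dist_eq]
    push_cast
    rw [Real.norm_eq_abs, mul_assoc, mul_assoc]
    exact mul_le_mul_of_nonneg_left h (abs_nonneg _)
  set D : NNReal := ‖(b x₀)⁻¹‖₊ * (C * ‖ρ‖₊)
  have h0 : b (x₀ + ρ • (0 : X)) / b x₀ = 1 := by simp [hx₀]
  refine ⟨_, 1 + D, by simp, hcd, h0, hz, fun x => ?_, fun x => ?_⟩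
  · rcases le_total 1 ‖x‖ with h | h
    · rw [hz x h, abs_zero]; positivity
    · have := hlip.dist_le_mul x 0
      simp only [h0, dist_zero_right, Real.dist_eq] at this
      have h2 := abs_sub_abs_le_abs_sub (b (x₀ + ρ • x) / b x₀) 1
      rw [abs_one] at h2
      have h3 : (D : ℝ) * ‖x‖ ≤ D := mul_le_of_le_one_right D.2 h
      linarith
  · have := norm_fderiv_le_of_lipschitz ℝ hlip (x₀ := x)
    linarith

theorem IsUnitBump.contDiff_scaled {b : X → ℝ} {S : ℝ} (hb : IsUnitBump b S) (s : ℝ) (z : X) :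
    ContDiff ℝ 1 fun x => b (s • (x - z)) :=
  hb.contDiff.comp (by fun_prop)

theorem IsUnitBump.norm_fderiv_scaled_le {b : X → ℝ} {S : ℝ} (hb : IsUnitBump b S) {s : ℝ}
    (hs : 0 ≤ s) (z x : X) : ‖fderiv ℝ (fun x => b (s • (x - z))) x‖ ≤ s * S := by
  have h1 : HasFDerivAt (fun x : X => s • (x - z)) (s • ContinuousLinearMap.id ℝ X) x :=
    ((hasFDerivAt_id x).sub_const z).const_smul s
  have h2 := (hb.contDiff.differentiable (by norm_num) (s • (x - z))).hasFDerivAt.comp x h1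
  have h3 : fderiv ℝ (fun x => b (s • (x - z))) x = _ := h2.fderiv
  rw [h3, ContinuousLinearMap.comp_smul, ContinuousLinearMap.comp_id, norm_smul,
    Real.norm_eq_abs, abs_of_nonneg hs]
  exact mul_le_mul_of_nonneg_left (hb.norm_fderiv_le _) hs

/-- A series of rescaled bumps with rapidly decreasing heights is a small `C^1` function. -/
theorem IsUnitBump.series {b : X → ℝ} {S : ℝ} (hb : IsUnitBump b S) {ε q : ℝ} (hε : 0 ≤ ε)
    (hq0 : 0 ≤ q) (hq : q ≤ 1 / 4) (z : ℕ → X) :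
    let u : ℕ → X → ℝ := fun n x => ε / (2 * S) * q ^ n * b ((2 : ℝ) ^ n • (x - z n))
    (∀ x, HasSum (fun n => u n x) (∑' n, u n x)) ∧ ContDiff ℝ 1 (fun x => ∑' n, u n x) ∧
      (∀ x, |∑' n, u n x| ≤ ε) ∧ ∀ x, ‖fderiv ℝ (fun x => ∑' n, u n x) x‖ ≤ ε := by
  intro u
  have hS : 0 < S := zero_lt_one.trans_le hb.one_le
  have hβ : 0 ≤ ε / (2 * S) := by positivity
  have hg : HasSum (fun n : ℕ => ε / 2 * (1 / 2 : ℝ) ^ n) ε := by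
    simpa using hasSum_geometric_two.mul_left (ε / 2)
  have hc : ∀ n, ContDiff ℝ 1 (u n) := fun n => contDiff_const.mul (hb.contDiff_scaled _ _)
  have hpow : ∀ n : ℕ, q ^ n * 2 ^ n ≤ (1 / 2 : ℝ) ^ n := fun n => by
    rw [← mul_pow]; exact pow_le_pow_left₀ (by positivity) (by linarith) n
  have hd : ∀ n x, ‖fderiv ℝ (u n) x‖ ≤ ε / 2 * (1 / 2 : ℝ) ^ n := by
    intro n x
    have h1 : fderiv ℝ (u n) x = _ := fderiv_const_mul
      ((hb.contDiff_scaled ((2 : ℝ) ^ n) (z n)).differentiable (by norm_num) x)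
      (ε / (2 * S) * q ^ n)
    rw [h1, norm_smul, Real.norm_eq_abs, abs_of_nonneg (by positivity)]
    calc _ ≤ ε / (2 * S) * q ^ n * (2 ^ n * S) :=
          mul_le_mul_of_nonneg_left (hb.norm_fderiv_scaled_le (by positivity) _ _) (by positivity)
      _ = ε / 2 * (q ^ n * 2 ^ n) := by field_simp
      _ ≤ _ := mul_le_mul_of_nonneg_left (hpow n) (by positivity)
  have ha : ∀ n x, ‖u n x‖ ≤ ε / 2 * (1 / 2 : ℝ) ^ n := by
    intro n x
    rw [Real.norm_eq_abs, abs_mul, abs_of_nonneg (by positivity : 0 ≤ ε / (2 * S) * q ^ n)]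
    calc _ ≤ ε / (2 * S) * q ^ n * S :=
          mul_le_mul_of_nonneg_left (hb.abs_le _) (by positivity)
      _ = ε / 2 * q ^ n := by field_simp
      _ ≤ _ := mul_le_mul_of_nonneg_left (pow_le_pow_left₀ hq0 (by linarith) n) (by positivity)
  have hs : ∀ x, Summable fun n => u n x := fun x => .of_norm_bounded hg.summable (ha · x)
  have hdf : fderiv ℝ (fun y => ∑' n, u n y) = fun x => ∑' n, fderiv ℝ (u n) x :=
    fderiv_tsum hg.summable (fun n => (hc n).differentiable (by norm_num)) hd (hs 0)
  refine ⟨fun x => (hs x).hasSum, ?_, fun x => ?_, fun x => ?_⟩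
  · rw [contDiff_one_iff_fderiv]
    refine ⟨fun x => (hasFDerivAt_tsum hg.summable
      (fun n x => ((hc n).differentiable (by norm_num) x).hasFDerivAt) hd (hs 0) x).differentiableAt,
      ?_⟩
    rw [hdf]
    exact continuous_tsum (fun n => (hc n).continuous_fderiv (by norm_num)) hg.summable hd
  · exact tsum_of_norm_bounded hg (ha · x)
  · rw [hdf]; exact tsum_of_norm_bounded hg (hd · x)

theorem exists_forall_le_add {ι : Type*} {A : Set ι} (hne : A.Nonempty) {G : ι → ℝ} {m : ℝ}
    (hm : ∀ x ∈ A, m ≤ G x) {α : ℝ} (hα : 0 < α) : ∃ x ∈ A, ∀ y ∈ A, G x ≤ G y + α := by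
  have hbd : BddBelow (G '' A) := ⟨m, by rintro _ ⟨x, hx, rfl⟩; exact hm x hx⟩
  obtain ⟨_, ⟨x, hx, rfl⟩, hlt⟩ := Real.lt_sInf_add_pos (hne.image G) hα
  exact ⟨x, hx, fun y hy => by linarith [csInf_le hbd (mem_image_of_mem G hy)]⟩

/-- The smooth variational principle: a lower semicontinuous function bounded below on a closed set
attains its minimum there after a `C^1`-small perturbation. -/
theorem IsUnitBump.exists_perturbation [CompleteSpace X] {b : X → ℝ} {S : ℝ} (hb : IsUnitBump b S)
    {A : Set X} (hA : IsClosed A) (hne : A.Nonempty) {F : X → ℝ} (hF : LowerSemicontinuousOn F A)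
    {m : ℝ} (hm : ∀ x ∈ A, m ≤ F x) {ε : ℝ} (hε : 0 < ε) :
    ∃ p : X → ℝ, ContDiff ℝ 1 p ∧ (∀ x, |p x| ≤ ε) ∧ (∀ x, ‖fderiv ℝ p x‖ ≤ ε) ∧
      ∃ x ∈ A, ∀ y ∈ A, F x + p x ≤ F y + p y := by
  classical
  have hS1 := hb.one_le
  have hS : 0 < S := zero_lt_one.trans_le hS1
  -- With this ratio all bumps after the `n`-th together change the function by at most `β n / 15`,
  -- too little to close the gap `β n / 2` opened by the `n`-th one.
  set q : ℝ := 1 / (16 * S) with hq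
  have hqS : q * S = 1 / 16 := by rw [hq]; field_simp
  have hq0 : 0 < q := by positivity
  have hq1 : q ≤ 1 / 16 := by nlinarith
  set β : ℕ → ℝ := fun n => ε / (2 * S) * q ^ n with hβ
  have hβ0 : ∀ n, 0 < β n := fun n => by positivity
  have hβs : ∀ n, β (n + 1) = q * β n := fun n => by simp only [hβ, pow_succ]; ring
  -- `pick G α` minimizes `G` on `A` up to `α`. Each stage then subtracts a bump of height `β n` and
  -- radius `2⁻ⁿ` centred at such a point.
  let pick : (X → ℝ) → ℝ → X := fun G α =>
    if h : ∃ x ∈ A, ∀ y ∈ A, G x ≤ G y + α then h.choose else hne.some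
  let G : ℕ → X → ℝ := fun n => Nat.rec F
    (fun n H x => H x - β n * b ((2 : ℝ) ^ n • (x - pick H (β n / 2)))) n
  let z : ℕ → X := fun n => pick (G n) (β n / 2)
  have hG : ∀ n x, G (n + 1) x = G n x - β n * b ((2 : ℝ) ^ n • (x - z n)) := fun n x => rfl
  have hGb : ∀ n, ∃ m, ∀ x ∈ A, m ≤ G n x := by
    intro n
    induction n with
    | zero => exact ⟨m, hm⟩
    | succ n ih =>
      obtain ⟨m, hm⟩ := ih
      refine ⟨m - β n * S, fun x hx => ?_⟩
      rw [hG]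
      have := mul_le_mul_of_nonneg_left (le_of_abs_le (hb.abs_le ((2 : ℝ) ^ n • (x - z n))))
        (hβ0 n).le
      linarith [hm x hx]
  have hz : ∀ n, z n ∈ A ∧ ∀ y ∈ A, G n (z n) ≤ G n y + β n / 2 := by
    intro n
    obtain ⟨m, hm⟩ := hGb n
    have h := exists_forall_le_add hne hm (half_pos (hβ0 n))
    simp only [z, pick, dif_pos h]
    exact h.choose_spec
  -- The subtracted `β (n + j)` lets the induction close: one step costs `β (n + j) / 16`, and `β`
  -- falls by a factor of at least `16`.
  have hT : ∀ n j x, |G (n + j + 1) x - G (n + 1) x| ≤ (β n - β (n + j)) / 15 := by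
    intro n j x
    induction j with
    | zero => simp
    | succ j ih =>
      have h1 : |G (n + (j + 1) + 1) x - G (n + j + 1) x| ≤ β (n + j) / 16 := by
        rw [hG (n + (j + 1)), ← add_assoc, sub_sub_cancel_left, abs_neg, abs_mul,
          abs_of_pos (hβ0 _), hβs]
        calc _ ≤ q * β (n + j) * S :=
              mul_le_mul_of_nonneg_left (hb.abs_le _) (mul_pos hq0 (hβ0 _)).le
          _ = q * S * β (n + j) := by ring
          _ = _ := by rw [hqS]; ring
      have h2 := abs_sub_le (G (n + (j + 1) + 1) x) (G (n + j + 1) x) (G (n + 1) x)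
      have h3 : β (n + (j + 1)) ≤ β (n + j) / 16 := by
        rw [← add_assoc, hβs]; nlinarith [hβ0 (n + j)]
      linarith
  have hout : ∀ n, ∀ y ∈ A, (1 / 2 : ℝ) ^ n ≤ ‖y - z n‖ → G (n + 1) (z n) + β n / 2 ≤
      G (n + 1) y := by
    intro n y hy hd
    have h1 : b ((2 : ℝ) ^ n • (y - z n)) = 0 := by
      apply hb.eq_zero
      rw [norm_smul, norm_pow, Real.norm_ofNat]
      calc (1 : ℝ) = 2 ^ n * (1 / 2) ^ n := by rw [← mul_pow]; norm_num
        _ ≤ _ := mul_le_mul_of_nonneg_left hd (by positivity)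
    rw [hG, hG, h1, sub_self, smul_zero, hb.map_zero]
    linarith [(hz n).2 y hy]
  have hclose : ∀ n, dist (z n) (z (n + 1)) ≤ 1 * (1 / 2 : ℝ) ^ n := by
    intro n
    by_contra! h
    rw [one_mul, dist_comm, dist_eq_norm] at h
    have h1 := hout n _ (hz (n + 1)).1 h.le
    have h2 := (hz (n + 1)).2 (z n) (hz n).1
    rw [hβs] at h2
    nlinarith [hβ0 n]
  obtain ⟨w, hw⟩ := cauchySeq_tendsto_of_complete
    (cauchySeq_of_le_geometric (1 / 2 : ℝ) 1 (by norm_num) hclose)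
  have hwA : w ∈ A := hA.mem_of_tendsto hw (.of_forall fun n => (hz n).1)
  obtain ⟨hs, hpc, hpa, hpd⟩ := hb.series hε.le hq0.le (by linarith) z
  set P : X → ℝ := fun x => ∑' n, ε / (2 * S) * q ^ n * b ((2 : ℝ) ^ n • (x - z n)) with hP
  have hlim : ∀ x, Tendsto (fun n => G n x) atTop (𝓝 (F x - P x)) := by
    intro x
    have h1 : ∀ n, G n x = F x -
        ∑ k ∈ Finset.range n, ε / (2 * S) * q ^ k * b ((2 : ℝ) ^ k • (x - z k)) := by
      intro n
      induction n with
      | zero => simp [G]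
      | succ n ih => rw [hG, ih, Finset.sum_range_succ]; ring
    simp_rw [h1]
    exact tendsto_const_nhds.sub (hs x).tendsto_sum_nat
  have hΦ : ∀ n x, |F x - P x - G (n + 1) x| ≤ β n / 15 := by
    intro n x
    have h1 : Tendsto (fun j => |G (n + j + 1) x - G (n + 1) x|) atTop
        (𝓝 |F x - P x - G (n + 1) x|) := by
      have h2 : Tendsto (fun j => n + j + 1) atTop atTop :=
        tendsto_atTop_mono (fun j => by show j ≤ n + j + 1; omega) tendsto_id
      exact (((hlim x).comp h2).sub_const _).abs
    exact le_of_tendsto h1 (.of_forall fun j => (hT n j x).trans (by linarith [hβ0 (n + j)]))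
  refine ⟨fun x => -P x, hpc.neg, fun x => ?_, fun x => ?_, w, hwA, fun y hy => ?_⟩
  · rw [abs_neg]; exact hpa x
  · rw [fderiv_fun_neg, norm_neg]; exact hpd x
  rcases eq_or_ne y w with rfl | hyw
  · exact le_rfl
  have hlsc : LowerSemicontinuousOn (fun x => F x + -P x) A :=
    hF.add (hpc.neg.continuous.lowerSemicontinuous.lowerSemicontinuousOn A)
  have hzA : Tendsto z atTop (𝓝[A] w) :=
    tendsto_nhdsWithin_iff.2 ⟨hw, .of_forall fun n => (hz n).1⟩
  -- Lower semicontinuity puts the value at `z n` above `r` for large `n`. Since `y ≠ w`, eventually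
  -- `y` is outside the `n`-th bump, so its value exceeds that at `z n`.
  refine le_of_forall_lt fun r hr => ?_
  have h1 := hzA.eventually (hlsc w hwA r hr)
  have h2 : ∀ᶠ n in atTop, (1 / 2 : ℝ) ^ n < ‖y - z n‖ :=
    (tendsto_pow_atTop_nhds_zero_of_lt_one (by norm_num) (by norm_num)).eventually_lt
      (tendsto_const_nhds.sub hw).norm (norm_pos_iff.2 (sub_ne_zero.2 hyw))
  obtain ⟨n, hn1, hn2⟩ := (h1.and h2).exists
  have h3 := hout n y hy hn2.le
  have h4 := _root_.abs_le.1 (hΦ n y)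
  have h5 := _root_.abs_le.1 (hΦ n (z n))
  have h6 := hβ0 n
  show r < F y + -P y
  have h7 : r < F (z n) + -P (z n) := hn1
  linarith [h4.1, h5.2]

/-- A mean value inequality for the subdifferential of a lower semicontinuous function. -/
theorem HasC1LipschitzBump.sub_le_of_subdifferential [CompleteSpace X] (hX : HasC1LipschitzBump X)
    {f : X → ℝ} {c : X} {R : ℝ} (hf : LowerSemicontinuousOn f (Metric.closedBall c (2 * R)))
    {m : ℝ} (hm : ∀ x ∈ Metric.closedBall c (2 * R), m ≤ f x) {x y : X}
    (hx : x ∈ Metric.ball c R) (hy : y ∈ Metric.ball c R) {C : ℝ}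
    (hC : ∀ z ∈ Metric.ball c (2 * R), ∀ g : X → ℝ, ContDiff ℝ 1 g →
      IsLocalMin (fun w => f w - g w) z → |fderiv ℝ g z (y - x)| ≤ C) :
    f y - f x ≤ C := by
  obtain ⟨b, S, hb⟩ := hX.exists_isUnitBump
  have hR : 0 < R := dist_nonneg.trans_lt hx
  have hRR : Metric.ball c R ⊆ Metric.closedBall c (2 * R) :=
    Metric.ball_subset_closedBall.trans (Metric.closedBall_subset_closedBall (by linarith))
  by_contra! hlt
  obtain ⟨r, hCr, hr⟩ := exists_between hlt
  set e := y - x with he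
  -- `η` bounds the perturbation `p` and its derivative: `2 * η` is lost when comparing values, `η *
  -- ‖e‖` when comparing differentials.
  obtain ⟨η, hη0, hη1, hη2⟩ : ∃ η > 0, f x + r + 2 * η < f y ∧ C + η * ‖e‖ < r := by
    obtain ⟨η₁, h1, h1'⟩ := exists_between (sub_pos.2 hr)
    obtain ⟨η₂, h2, h2'⟩ := exists_between (sub_pos.2 hCr)
    have hN : 0 < ‖e‖ + 1 := by positivity
    refine ⟨min (η₁ / 2) (η₂ / (‖e‖ + 1)), by positivity, ?_, ?_⟩
    · linarith [min_le_left (η₁ / 2) (η₂ / (‖e‖ + 1))]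
    · have h3 : min (η₁ / 2) (η₂ / (‖e‖ + 1)) * ‖e‖ ≤ η₂ / (‖e‖ + 1) * (‖e‖ + 1) :=
        mul_le_mul (min_le_right _ _) (by linarith) (by positivity) (by positivity)
      rw [div_mul_cancel₀ _ hN.ne'] at h3
      linarith
  obtain ⟨δ, hδ0, hδR, hδ⟩ : ∃ δ > 0, δ ≤ R ∧ ∀ w ∈ Metric.closedBall c (2 * R), ‖w - y‖ < δ →
      f x + r + 2 * η < f w := by
    have := hf y (hRR hy) _ hη1
    obtain ⟨δ, h0, h⟩ := Metric.mem_nhdsWithin_iff.1 this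
    exact ⟨min δ R, by positivity, min_le_right _ _, fun w hw hwy =>
      h ⟨by rw [Metric.mem_ball, dist_eq_norm]; exact hwy.trans_le (min_le_left _ _), hw⟩⟩
  -- Large enough that a minimizer at distance at least `δ` from its point of the segment would do
  -- worse than `x` with `t = 0`.
  set l : ℝ := f x + 2 * η + 1 + |r| - m with hl
  have hψ : ContDiff ℝ 1 fun v : X => (1 - b (δ⁻¹ • v)) ^ 2 :=
    (contDiff_const.sub (hb.contDiff.comp (by fun_prop))).pow 2
  set ψ : X → ℝ := fun v => (1 - b (δ⁻¹ • v)) ^ 2 with hψdef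
  have hψ0 : ψ 0 = 0 := by simp [hψdef, hb.map_zero]
  have hψn : ∀ v, 0 ≤ ψ v := fun v => sq_nonneg _
  have hψ1 : ∀ v, δ ≤ ‖v‖ → ψ v = 1 := fun v hv => by
    have : b (δ⁻¹ • v) = 0 := hb.eq_zero _ (by
      rw [norm_smul, norm_inv, Real.norm_eq_abs, abs_of_pos hδ0, ← div_eq_inv_mul]
      exact (one_le_div hδ0).2 hv)
    simp [hψdef, this]
  let k : X → ℝ → ℝ := fun w t => l * ψ (w - x - t • e) - r * t
  have hk : Continuous (Function.uncurry k) := by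
    have := hψ.continuous
    simp only [k, Function.uncurry_def]
    fun_prop
  have hI : IsCompact (Icc (0 : ℝ) 1) := isCompact_Icc
  -- Taking the infimum over the compact parameter interval reduces a joint minimization in `(w, t)`
  -- to the variational principle on `X`. Only continuity of `κ` is needed, since differentiation is
  -- done on `k` in each variable separately.
  let κ : X → ℝ := fun w => sInf (k w '' Icc 0 1)
  have hκ : Continuous κ := hI.continuous_sInf hk
  have hkw : ∀ w, ContinuousOn (k w) (Icc 0 1) := fun w =>
    (hk.comp (Continuous.prodMk_right w)).continuousOn
  have hκle : ∀ w, ∀ t ∈ Icc (0 : ℝ) 1, κ w ≤ k w t := fun w t ht =>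
    csInf_le (hI.bddBelow_image (hkw w)) (mem_image_of_mem _ ht)
  have hκex : ∀ w, ∃ t ∈ Icc (0 : ℝ) 1, κ w = k w t := fun w => by
    obtain ⟨t, ht, h, -⟩ := hI.exists_sInf_image_eq_and_le ⟨0, by simp⟩ (hkw w)
    exact ⟨t, ht, h⟩
  have hxx : x ∈ Metric.closedBall c (2 * R) := hRR hx
  have hl0 : 0 < l := by have := hm x hxx; have := abs_nonneg r; linarith
  have hrt : ∀ t ∈ Icc (0 : ℝ) 1, r * t ≤ |r| := fun t ht => by
    have := mul_le_mul (le_abs_self r) ht.2 ht.1 (abs_nonneg r); linarith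
  obtain ⟨p, hpc, hpa, hpd, w, hwA, hmin⟩ := hb.exists_perturbation
    (F := fun w => f w + κ w) (m := m - |r|) Metric.isClosed_closedBall ⟨x, hxx⟩
    (hf.add (hκ.lowerSemicontinuous.lowerSemicontinuousOn _)) (fun w hw => by
      obtain ⟨t, ht, h⟩ := hκex w
      have h1 := hm w hw
      have h2 := hrt t ht
      have h3 := mul_nonneg hl0.le (hψn (w - x - t • e))
      simp only [h, k]; linarith) hη0
  obtain ⟨t, ht, hkt⟩ := hκex w
  have hmin' : ∀ v ∈ Metric.closedBall c (2 * R), ∀ s ∈ Icc (0 : ℝ) 1,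
      f w + k w t + p w ≤ f v + k v s + p v := fun v hv s hs => by
    have h1 := hmin v hv
    have h2 := hκle v s hs
    simp only [hkt] at h1
    linarith
  have hval : f w + k w t ≤ f x + 2 * η := by
    have h1 := hmin' x hxx 0 (by simp)
    have h2 : k x 0 = 0 := by simp [k, hψ0]
    have h3 := abs_le.1 (hpa x)
    have h4 := abs_le.1 (hpa w)
    linarith [h3.2, h4.1]
  have hwm := hm w hwA
  have hrt' := hrt t ht
  have hnear : ‖w - x - t • e‖ < δ := by
    by_contra! h
    simp only [k, hψ1 _ h] at hval
    linarith
  have hwb : w ∈ Metric.ball c (2 * R) := by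
    have h1 : x + t • e ∈ Metric.ball c R := by
      have := (convex_ball c R) hx hy (sub_nonneg.2 ht.2) ht.1 (by ring)
      convert this using 1
      rw [he]; module
    rw [mem_ball_iff_norm] at h1 ⊢
    calc ‖w - c‖ = ‖(w - x - t • e) + (x + t • e - c)‖ := by congr 1; abel
      _ ≤ _ := norm_add_le _ _
      _ < 2 * R := by linarith
  -- At `t = 1` the point `w` would be `δ`-close to `y`, where `f` is too large. Hence `t` can be
  -- increased, and the one-sided derivative there gives `htd`, even if `t = 0`.
  have ht1 : t < 1 := by
    refine lt_of_le_of_ne ht.2 fun h => ?_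
    subst h
    have h1 := hδ w hwA (by convert hnear using 2; rw [he]; module)
    have h3 := mul_nonneg hl0.le (hψn (w - x - (1 : ℝ) • e))
    simp only [k] at hval
    linarith
  have hψd : ∀ v, HasFDerivAt ψ (fderiv ℝ ψ v) v := fun v =>
    (hψ.differentiable (by norm_num) v).hasFDerivAt
  set v₀ := w - x - t • e with hv₀
  have htd : r ≤ -(l * fderiv ℝ ψ v₀ e) := by
    have h1 : HasDerivAt (fun s : ℝ => w - x - s • e) (-e) t := by
      simpa using ((hasDerivAt_id t).smul_const e).const_sub (w - x)
    have h1' : HasDerivAt (fun s : ℝ => ψ (w - x - s • e)) (fderiv ℝ ψ v₀ (-e)) t := by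
      have h0 := hψd (w - x - t • e)
      have h0' := h0.comp_hasDerivAt t h1
      exact h0'
    have h2 : HasDerivAt (fun s => k w s) (l * (fderiv ℝ ψ v₀ (-e)) - r * 1) t :=
      (h1'.const_mul l).sub ((hasDerivAt_id t).const_mul r)
    have h3 : IsLocalMinOn (fun s => k w s) (Icc t 1) t := by
      refine IsMinOn.localize fun s hs => ?_
      have := hmin' w hwA s ⟨ht.1.trans hs.1, hs.2⟩
      show k w t ≤ k w s
      linarith
    have h4 := h3.hasFDerivWithinAt_nonneg h2.hasFDerivAt.hasFDerivWithinAt (y := 1 - t)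
      (sub_mem_posTangentConeAt_of_segment_subset (by rw [segment_eq_Icc ht1.le]))
    simp only [map_neg, ContinuousLinearMap.toSpanSingleton_apply, smul_eq_mul] at h4
    have h5 : 0 ≤ l * -(fderiv ℝ ψ v₀ e) - r * 1 :=
      nonneg_of_mul_nonneg_right h4 (sub_pos.2 ht1)
    linarith
  have hgc : ContDiff ℝ 1 fun v => -(l * ψ (v - (x + t • e)) + p v) :=
    ((contDiff_const.mul (hψ.comp (contDiff_id.sub contDiff_const))).add hpc).neg
  have hgd : HasFDerivAt (fun v => -(l * ψ (v - (x + t • e)) + p v))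
      (-(l • fderiv ℝ ψ v₀ + fderiv ℝ p w)) w := by
    have h1 : HasFDerivAt (fun v => ψ (v - (x + t • e))) (fderiv ℝ ψ v₀) w := by
      have h2 : v₀ = w - (x + t • e) := by rw [hv₀]; abel
      have := (hψd v₀)
      rw [h2] at this ⊢
      have h3 : HasFDerivAt (fun v => v - (x + t • e)) (ContinuousLinearMap.id ℝ X) w :=
        (hasFDerivAt_id w).sub_const (x + t • e)
      have h4 := HasFDerivAt.comp w this h3
      rwa [ContinuousLinearMap.comp_id] at h4
    exact ((h1.const_mul l).add (hpc.differentiable (by norm_num) w).hasFDerivAt).neg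
  have hfin := hC w hwb _ hgc (by
    filter_upwards [Metric.isOpen_ball.mem_nhds hwb] with v hv
    have h1 := hmin' v (Metric.ball_subset_closedBall hv) t ht
    simp only [k, sub_sub] at h1 ⊢
    linarith)
  rw [hgd.fderiv] at hfin
  have h1 := (le_abs_self _).trans hfin
  have h2 : |fderiv ℝ p w e| ≤ η * ‖e‖ :=
    (fderiv ℝ p w).le_of_opNorm_le (hpd w) e
  have h3 := abs_le.1 h2
  simp only [neg_apply, add_apply, smul_apply, smul_eq_mul] at h1
  linarith [h3.2]

end BanachSpace

/-! ### Subdifferentials and the mean value inequality in charts -/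

section Manifold

variable {X : Type*} [NormedAddCommGroup X] [NormedSpace ℝ X]
  {M : Type*} [TopologicalSpace M]

/-- Lower semicontinuity bounds `f` below near a point, so the mean value inequality applies on a
small ball of the chart. `C` may depend on `x` and `y`, so it can later be a multiple of the Finsler
norm of `y - x`. -/
theorem exists_forall_sub_le [CompleteSpace X] (hX : HasC1LipschitzBump X) {f : M → ℝ}
    (hf : LowerSemicontinuous f) {φ : OpenPartialHomeomorph M X} {u : X} (hu : u ∈ φ.target)
    {V : Set X} (hV : V ∈ 𝓝 u) :
    ∃ R > 0, Metric.closedBall u (2 * R) ⊆ φ.target ∩ V ∧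
      ∀ x ∈ Metric.ball u R, ∀ y ∈ Metric.ball u R, ∀ C,
        (∀ z ∈ Metric.ball u (2 * R), ∀ g : X → ℝ, ContDiff ℝ 1 g →
          IsLocalMin (fun w => f (φ.symm w) - g w) z → |fderiv ℝ g z (y - x)| ≤ C) →
        f (φ.symm y) - f (φ.symm x) ≤ C := by
  have hlow : ∀ᶠ w in 𝓝 u, f (φ.symm u) - 1 < f (φ.symm w) :=
    (φ.symm.continuousAt hu).eventually (hf (φ.symm u) _ (by linarith))
  obtain ⟨ρ, hρ, hball⟩ := Metric.nhds_basis_closedBall.mem_iff.1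
    (inter_mem (inter_mem (φ.open_target.mem_nhds hu) hV) hlow)
  have hρ2 : 2 * (ρ / 2) = ρ := by ring
  refine ⟨ρ / 2, half_pos hρ, by rw [hρ2]; exact hball.trans inter_subset_left, fun x hx y hy C hC => ?_⟩
  refine hX.sub_le_of_subdifferential (f := fun w => f (φ.symm w)) (m := f (φ.symm u) - 1)
    ?_ ?_ hx hy hC
  · intro w hw r hr
    rw [hρ2] at hw
    exact (((φ.symm.continuousAt (hball hw).1.1).eventually (hf (φ.symm w) r hr))).filter_mono
      nhdsWithin_le_nhds
  · intro w hw
    rw [hρ2] at hw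
    exact (hball hw).2.le

variable [ChartedSpace X M]

theorem chartNorm_symm (nrm : (x : M) → TangentSpace 𝓘(ℝ, X) x → ℝ)
    (φ : OpenPartialHomeomorph M X) {u : X} (hu : u ∈ φ.target) (v : X) :
    chartNorm nrm φ (φ.symm u) v =
      nrm (φ.symm u) (mfderiv 𝓘(ℝ, X) 𝓘(ℝ, X) φ.symm u v) := by
  unfold chartNorm
  rw [φ.right_inv hu]

theorem mdifferentiable_of_mem_maximalAtlas {φ : OpenPartialHomeomorph M X}
    (hφ : φ ∈ IsManifold.maximalAtlas 𝓘(ℝ, X) 1 M) :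
    φ.MDifferentiable 𝓘(ℝ, X) 𝓘(ℝ, X) :=
  ⟨(contMDiffOn_of_mem_maximalAtlas hφ).mdifferentiableOn (by norm_num),
    (contMDiffOn_symm_of_mem_maximalAtlas hφ).mdifferentiableOn (by norm_num)⟩

/-- A `C^1` function in a chart agrees near a given point with a globally defined one. -/
theorem IsUnitBump.exists_extension [RegularSpace M] {b : X → ℝ} {S : ℝ} (hb : IsUnitBump b S)
    {φ : OpenPartialHomeomorph M X} (hφ : φ ∈ IsManifold.maximalAtlas 𝓘(ℝ, X) 1 M) {u : X}
    (hu : u ∈ φ.target) {g : X → ℝ} (hg : ContDiff ℝ 1 g) :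
    ∃ G : M → ℝ, ContMDiff 𝓘(ℝ, X) 𝓘(ℝ, ℝ) 1 G ∧ ∀ᶠ y in 𝓝 (φ.symm u), G y = g (φ y) := by
  classical
  -- The support must lie in a set closed in `M`, not just in the chart domain, for the extension by
  -- zero to be `C^1`.
  obtain ⟨D, hD, hDc, hDs⟩ := exists_mem_nhds_isClosed_subset
    (φ.open_source.mem_nhds (φ.map_target hu))
  obtain ⟨δ, hδ, hball⟩ := Metric.mem_nhds_iff.1
    ((φ.symm.continuousAt hu).preimage_mem_nhds hD)
  let χ : X → ℝ := fun v => Real.smoothTransition (2 * b (δ⁻¹ • (v - u)))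
  have hχ : ContDiff ℝ 1 χ :=
    Real.smoothTransition.contDiff.comp (contDiff_const.mul (hb.contDiff_scaled δ⁻¹ u))
  have hχ0 : ∀ v, χ v ≠ 0 → v ∈ Metric.ball u δ := by
    intro v hv
    by_contra h
    rw [mem_ball_iff_norm, not_lt] at h
    refine hv (Real.smoothTransition.zero_of_nonpos ?_)
    rw [hb.eq_zero, mul_zero]
    rw [norm_smul, norm_inv, Real.norm_eq_abs, abs_of_pos hδ, ← div_eq_inv_mul]
    exact (one_le_div hδ).2 h
  have hχ1 : ∀ᶠ v in 𝓝 u, χ v = 1 := by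
    have hc : ContinuousAt (fun v => 2 * b (δ⁻¹ • (v - u))) u :=
      (continuous_const.mul (hb.contDiff_scaled δ⁻¹ u).continuous).continuousAt
    have h1 : (1 : ℝ) < 2 * b (δ⁻¹ • (u - u)) := by
      rw [sub_self, smul_zero, hb.map_zero]; norm_num
    filter_upwards [hc.eventually_const_lt h1] with v hv
    exact Real.smoothTransition.one_of_one_le hv.le
  let G : M → ℝ := φ.source.indicator fun y => χ (φ y) * g (φ y)
  have hsup : tsupport G ⊆ φ.source := by
    refine (closure_minimal (fun y hy => ?_) hDc).trans hDs
    have hys : y ∈ φ.source := mem_of_indicator_ne_zero hy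
    have h1 : χ (φ y) ≠ 0 := by
      intro h
      refine hy ?_
      simp [G, h]
    have := hball (hχ0 _ h1)
    rwa [mem_preimage, φ.left_inv hys] at this
  have hGeq : ∀ y ∈ φ.source, G =ᶠ[𝓝 y] fun y => χ (φ y) * g (φ y) := fun y hy => by
    filter_upwards [φ.open_source.mem_nhds hy] with z hz using indicator_of_mem hz _
  refine ⟨G, contMDiff_of_tsupport fun y hy => ?_, ?_⟩
  · have hys := hsup hy
    refine ContMDiffAt.congr_of_eventuallyEq ?_ (hGeq y hys)
    exact (hχ.mul hg).contMDiff.contMDiffAt.comp y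
      (contMDiffAt_of_mem_maximalAtlas hφ hys)
  · have hx := φ.map_target hu
    have hcont : Tendsto φ (𝓝 (φ.symm u)) (𝓝 u) := by
      simpa only [ContinuousAt, φ.right_inv hu] using φ.continuousAt hx
    filter_upwards [hGeq _ hx, hcont.eventually hχ1] with y h1 h2
    rw [h1, h2, one_mul]

variable [IsManifold 𝓘(ℝ, X) 1 M]

theorem exists_chart_symm_eq (x : M) : ∃ φ ∈ IsManifold.maximalAtlas 𝓘(ℝ, X) 1 M,
    ∃ u ∈ φ.target, φ.symm u = x :=
  ⟨chartAt X x, IsManifold.chart_mem_maximalAtlas x, chartAt X x x,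
    mem_chart_target X x, (chartAt X x).left_inv (mem_chart_source X x)⟩

namespace FinslerStructure

variable (F : FinslerStructure X M)

theorem nrm_zero (x : M) : F.nrm x 0 = 0 := by
  simpa using F.smul x 0 0

theorem exists_chart_bounds {φ : OpenPartialHomeomorph M X}
    (hφ : φ ∈ IsManifold.maximalAtlas 𝓘(ℝ, X) 1 M) {u : X} (hu : u ∈ φ.target) :
    ∃ C : ℝ, 1 ≤ C ∧ ∀ v : X,
      ‖v‖ ≤ C * F.nrm (φ.symm u) (mfderiv 𝓘(ℝ, X) 𝓘(ℝ, X) φ.symm u v) ∧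
      F.nrm (φ.symm u) (mfderiv 𝓘(ℝ, X) 𝓘(ℝ, X) φ.symm u v) ≤ C * ‖v‖ := by
  obtain ⟨C, hC, h⟩ := F.equiv φ hφ (φ.symm u) (φ.map_target hu)
  refine ⟨C, hC, fun v => ?_⟩
  obtain ⟨h1, h2⟩ := h v
  rw [chartNorm_symm F.nrm φ hu v] at h1 h2
  exact ⟨(inv_mul_le_iff₀ (zero_lt_one.trans_le hC)).1 h1, h2⟩

/-- By (P1) the supremum defining the dual norm is over a bounded set, so it is not the default
value `0` of `sSup`. -/
theorem exists_abs_le_mul_nrm (x : M) (ξ : TangentSpace 𝓘(ℝ, X) x →L[ℝ] ℝ) :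
    ∃ C, ∀ v, |ξ v| ≤ C * F.nrm x v := by
  obtain ⟨φ, hφ, u, hu, rfl⟩ := exists_chart_symm_eq (X := X) x
  obtain ⟨C, -, h⟩ := F.exists_chart_bounds hφ hu
  let η : X →L[ℝ] ℝ := ξ.comp (mfderiv 𝓘(ℝ, X) 𝓘(ℝ, X) φ.symm u)
  refine ⟨‖η‖ * C, fun v => ?_⟩
  obtain ⟨w, rfl⟩ := (mdifferentiable_of_mem_maximalAtlas hφ).symm.mfderiv_surjective hu v
  rw [mul_assoc]
  exact (η.le_opNorm w).trans (mul_le_mul_of_nonneg_left (h w).1 (norm_nonneg _))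

theorem dualNorm_nonneg (x : M) (ξ : TangentSpace 𝓘(ℝ, X) x →L[ℝ] ℝ) : 0 ≤ F.dualNorm x ξ :=
  Real.sSup_nonneg (by rintro _ ⟨v, -, rfl⟩; exact abs_nonneg _)

theorem abs_le_dualNorm_mul (x : M) (ξ : TangentSpace 𝓘(ℝ, X) x →L[ℝ] ℝ)
    (v : TangentSpace 𝓘(ℝ, X) x) : |ξ v| ≤ F.dualNorm x ξ * F.nrm x v := by
  obtain ⟨C, hC⟩ := F.exists_abs_le_mul_nrm x ξ
  rcases (F.nonneg x v).eq_or_lt' with h | h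
  · rw [F.eq_zero x v h, map_zero, abs_zero, F.nrm_zero, mul_zero]
  · have hn : F.nrm x ((F.nrm x v)⁻¹ • v) = 1 := by
      rw [F.smul, abs_inv, abs_of_pos h, inv_mul_cancel₀ h.ne']
    have hle : |ξ ((F.nrm x v)⁻¹ • v)| ≤ F.dualNorm x ξ := by
      refine le_csSup ⟨C, ?_⟩ ⟨_, hn, rfl⟩
      rintro _ ⟨w, hw, rfl⟩
      simpa [hw] using hC w
    rw [map_smul, smul_eq_mul, abs_mul, abs_inv, abs_of_pos h, inv_mul_le_iff₀ h] at hle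
    linarith

end FinslerStructure

variable (F : FinslerStructure X M)

/-- The bound for the subdifferentials of `f`, read in a chart. -/
theorem FinslerStructure.abs_fderiv_le_of_isLocalMin [RegularSpace M]
    (hX : HasC1LipschitzBump X) {f : M → ℝ} {K : ℝ}
    (hK : ∀ x : M, ∀ ξ ∈ subdifferential X f x, F.dualNorm x ξ ≤ K)
    {φ : OpenPartialHomeomorph M X} (hφ : φ ∈ IsManifold.maximalAtlas 𝓘(ℝ, X) 1 M) {u : X}
    (hu : u ∈ φ.target) {g : X → ℝ} (hg : ContDiff ℝ 1 g)
    (hmin : IsLocalMin (fun w => f (φ.symm w) - g w) u) :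
    0 ≤ K ∧ ∀ v, |fderiv ℝ g u v| ≤
      K * F.nrm (φ.symm u) (mfderiv 𝓘(ℝ, X) 𝓘(ℝ, X) φ.symm u v) := by
  obtain ⟨b, S, hb⟩ := hX.exists_isUnitBump
  obtain ⟨G, hG, hGg⟩ := hb.exists_extension hφ hu hg
  have hx := φ.map_target hu
  have hcont : Tendsto φ (𝓝 (φ.symm u)) (𝓝 u) := by
    simpa only [ContinuousAt, φ.right_inv hu] using φ.continuousAt hx
  set ξ := mfderiv 𝓘(ℝ, X) 𝓘(ℝ, ℝ) G (φ.symm u) with hξ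
  have hmem : ξ ∈ subdifferential X f (φ.symm u) := by
    refine ⟨G, hG, ?_, hξ⟩
    filter_upwards [hGg, hcont.eventually hmin, φ.open_source.mem_nhds hx] with y h1 h2 h3
    rw [h1, hGg.self_of_nhds, φ.right_inv hu]
    rwa [φ.left_inv h3] at h2
  have hle := hK _ ξ hmem
  refine ⟨(F.dualNorm_nonneg _ _).trans hle, fun v => ?_⟩
  have hmd := mdifferentiable_of_mem_maximalAtlas hφ
  have hcomp : mfderiv 𝓘(ℝ, X) 𝓘(ℝ, ℝ) (G ∘ φ.symm) u =
      ξ.comp (mfderiv 𝓘(ℝ, X) 𝓘(ℝ, X) φ.symm u) :=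
    mfderiv_comp u ((hG _).mdifferentiableAt (by norm_num)) (hmd.mdifferentiableAt_symm hu)
  have heq : G ∘ φ.symm =ᶠ[𝓝 u] g := by
    filter_upwards [(φ.symm.continuousAt hu).eventually hGg, φ.open_target.mem_nhds hu]
      with w h1 h2
    rw [Function.comp_apply, h1, φ.right_inv h2]
  rw [heq.mfderiv_eq, mfderiv_eq_fderiv] at hcomp
  have hv : fderiv ℝ g u v = ξ (mfderiv 𝓘(ℝ, X) 𝓘(ℝ, X) φ.symm u v) := by
    rw [hcomp]; rfl
  rw [hv]
  exact (F.abs_le_dualNorm_mul _ _ _).trans (mul_le_mul_of_nonneg_right hle (F.nonneg _ _))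

/-- Any subdifferential forces `0 ≤ K`. If `K < 0` there are none, and the mean value inequality
with `x = y` and `C = -1` becomes vacuous in its hypothesis and absurd in its conclusion. -/
theorem FinslerStructure.nonneg_of_dualNorm_le [CompleteSpace X] [RegularSpace M] [Nonempty M]
    (hX : HasC1LipschitzBump X) {f : M → ℝ} (hf : LowerSemicontinuous f) {K : ℝ}
    (hK : ∀ x : M, ∀ ξ ∈ subdifferential X f x, F.dualNorm x ξ ≤ K) : 0 ≤ K := by
  by_contra hneg
  obtain ⟨φ, hφ, u, hu, -⟩ := exists_chart_symm_eq (X := X) (Classical.arbitrary M)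
  obtain ⟨R, hR, hsub, h⟩ := exists_forall_sub_le hX hf hu univ_mem
  have := h u (Metric.mem_ball_self hR) u (Metric.mem_ball_self hR) (-1) fun z hz g hg hmin =>
    absurd (F.abs_fderiv_le_of_isLocalMin hX hK hφ (hsub (Metric.ball_subset_closedBall hz)).1
      hg hmin).1 hneg
  rw [sub_self] at this
  norm_num at this

/-- Near each point, `f` is almost `K`-Lipschitz for the norm of the tangent space at the point. -/
theorem FinslerStructure.eventually_abs_sub_le [CompleteSpace X] [RegularSpace M]
    (hX : HasC1LipschitzBump X) {f : M → ℝ} (hf : LowerSemicontinuous f) {K : ℝ}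
    (hK : ∀ x : M, ∀ ξ ∈ subdifferential X f x, F.dualNorm x ξ ≤ K)
    {φ : OpenPartialHomeomorph M X} (hφ : φ ∈ IsManifold.maximalAtlas 𝓘(ℝ, X) 1 M) {u : X}
    (hu : u ∈ φ.target) {ε : ℝ} (hε : 0 < ε) :
    ∀ᶠ y in 𝓝 u, |f (φ.symm y) - f (φ.symm u)| ≤
      K * (1 + ε) * F.nrm (φ.symm u) (mfderiv 𝓘(ℝ, X) 𝓘(ℝ, X) φ.symm u (y - u)) := by
  have : Nonempty M := ⟨φ.symm u⟩
  have hK0 := F.nonneg_of_dualNorm_le hX hf hK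
  obtain ⟨W, hWo, hxW, -, hW⟩ := F.palais φ hφ (φ.symm u) (φ.map_target hu) ε hε
  obtain ⟨R, hR, hsub, h⟩ := exists_forall_sub_le hX hf hu
    ((φ.symm.continuousAt hu).preimage_mem_nhds (hWo.mem_nhds hxW))
  have key : ∀ z ∈ Metric.ball u (2 * R), ∀ g : X → ℝ, ContDiff ℝ 1 g →
      IsLocalMin (fun w => f (φ.symm w) - g w) z → ∀ v, |fderiv ℝ g z v| ≤
        K * (1 + ε) * F.nrm (φ.symm u) (mfderiv 𝓘(ℝ, X) 𝓘(ℝ, X) φ.symm u v) := by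
    intro z hz g hg hmin v
    obtain ⟨hzt, hzW⟩ := hsub (Metric.ball_subset_closedBall hz)
    have h1 := (hW _ hzW v).2
    rw [chartNorm_symm F.nrm φ hu, chartNorm_symm F.nrm φ hzt] at h1
    rw [mul_assoc]
    exact ((F.abs_fderiv_le_of_isLocalMin hX hK hφ hzt hg hmin).2 v).trans
      (mul_le_mul_of_nonneg_left h1 hK0)
  filter_upwards [Metric.ball_mem_nhds u hR] with y hy
  refine abs_sub_le_iff.2 ⟨?_, ?_⟩
  · exact h u (Metric.mem_ball_self hR) y hy _ fun z hz g hg hmin => key z hz g hg hmin _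
  · refine h y hy u (Metric.mem_ball_self hR) _ fun z hz g hg hmin => ?_
    rw [← neg_sub y u, map_neg, abs_neg]
    exact key z hz g hg hmin _

end Manifold

/-! ### Integration along piecewise `C^1` paths -/

section Paths

/-- The right slopes of `h` and `-h` are compared with the derivative of a primitive of `n`, after
extending `n` by its endpoint values to a continuous function on the line. -/
theorem abs_sub_le_integral {h n : ℝ → ℝ} {a b : ℝ} (hab : a ≤ b) (hh : ContinuousOn h (Icc a b))
    (hn : ContinuousOn n (Icc a b))
    (hs : ∀ t ∈ Ico a b, ∀ r, n t < r → ∀ᶠ z in 𝓝[>] t, |h z - h t| < r * (z - t)) :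
    |h b - h a| ≤ ∫ t in a..b, n t := by
  set N : ℝ → ℝ := IccExtend hab ((Icc a b).domRestrict n) with hN
  have hNc : Continuous N := (continuousOn_iff_continuous_domRestrict.1 hn).Icc_extend'
  have hNn : ∀ t ∈ Icc a b, N t = n t := fun t ht => IccExtend_of_mem hab _ ht
  have hint : ∫ t in a..b, n t = ∫ t in a..b, N t :=
    intervalIntegral.integral_congr fun t ht => (hNn t (by rwa [uIcc_of_le hab] at ht)).symm
  have hB : ∀ t, HasDerivAt (fun s => ∫ u in a..s, N u) (N t) t := fun t =>
    intervalIntegral.integral_hasDerivAt_right (hNc.intervalIntegrable _ _)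
      (hNc.stronglyMeasurableAtFilter _ _) hNc.continuousAt
  have key : ∀ k : ℝ → ℝ, ContinuousOn k (Icc a b) →
      (∀ z t, |k z - k t| = |h z - h t|) → k b - k a ≤ ∫ t in a..b, n t := by
    intro k hk hkh
    have := image_le_of_liminf_slope_right_le_deriv_boundary (f := k) (a := a) (b := b) hk
      (B := fun s => k a + ∫ u in a..s, N u) (B' := N) (by simp)
      (fun t _ => ((hB t).continuousAt.const_add _).continuousWithinAt)
      (fun t _ => ((hB t).const_add _).hasDerivWithinAt)
      (fun t ht r hr => by
        rw [hNn t (Ico_subset_Icc_self ht)] at hr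
        refine Eventually.frequently ?_
        filter_upwards [hs t ht r hr, self_mem_nhdsWithin] with z hz hzt
        rw [slope_def_field, div_lt_iff₀ (sub_pos.2 hzt)]
        exact (le_abs_self _).trans_lt ((hkh z t).trans_lt hz))
      (right_mem_Icc.2 hab)
    rw [hint]
    linarith
  refine abs_sub_le_iff.2 ⟨key h hh fun _ _ => rfl, ?_⟩
  have := key (fun t => -h t) hh.neg fun z t => by rw [neg_sub_neg, abs_sub_comm]
  linarith

variable {X : Type*} [NormedAddCommGroup X] [NormedSpace ℝ X]
  {M : Type*} [TopologicalSpace M] [ChartedSpace X M]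

variable (X) in
/-- There is a piecewise `C^1` path from `p` to `q`. -/
def IsPiecewiseC1Joined (p q : M) : Prop :=
  ∃ (a b : ℝ) (c : ℝ → M), a ≤ b ∧ IsPiecewiseC1 X c a b ∧ c a = p ∧ c b = q

theorem IsPiecewiseC1Joined.refl (p : M) : IsPiecewiseC1Joined X p p :=
  ⟨0, 0, fun _ => p, le_rfl, ⟨continuousOn_const, 0, fun _ => 0, monotone_const, rfl, rfl,
    fun i hi => absurd hi (Nat.not_lt_zero i)⟩, rfl, rfl⟩

theorem IsPiecewiseC1Joined.extend {φ : OpenPartialHomeomorph M X}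
    (hφ : φ ∈ IsManifold.maximalAtlas 𝓘(ℝ, X) 1 M) {p : M} {y z : X}
    (hp : IsPiecewiseC1Joined X p (φ.symm y)) (hyz : segment ℝ y z ⊆ φ.target) :
    IsPiecewiseC1Joined X p (φ.symm z) := by
  obtain ⟨a, b, c, hab, ⟨hcc, n, t, ht, rfl, rfl, hct⟩, rfl, hcb⟩ := hp
  set b := t n
  let γ : ℝ → M := fun s => φ.symm (y + (s - b) • (z - y))
  let e : ℝ → M := fun s => if s ≤ b then c s else γ s
  have hγ : ContMDiffOn 𝓘(ℝ, ℝ) 𝓘(ℝ, X) 1 γ (Icc b (b + 1)) := by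
    have h1 : ContDiff ℝ 1 fun s : ℝ => y + (s - b) • (z - y) := by fun_prop
    refine (contMDiffOn_symm_of_mem_maximalAtlas hφ).comp h1.contMDiff.contMDiffOn fun s hs => ?_
    refine hyz ?_
    rw [segment_eq_image']
    exact ⟨s - b, ⟨by linarith [hs.1], by linarith [hs.2]⟩, rfl⟩
  have hec : ∀ s ≤ b, e s = c s := fun s hs => if_pos hs
  have heγ : ∀ s, b ≤ s → e s = γ s := fun s hs => by
    rcases hs.eq_or_lt with rfl | h
    · rw [hec _ le_rfl, hcb]; simp [γ]
    · exact if_neg h.not_ge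
  have hγe : ContMDiffOn 𝓘(ℝ, ℝ) 𝓘(ℝ, X) 1 e (Icc b (b + 1)) :=
    hγ.congr fun s hs => heγ s hs.1
  -- The chart segment is appended on `[b, b + 1]`. The subdivision stays constant afterwards, since
  -- it must be monotone on all of `ℕ`.
  refine ⟨t 0, b + 1, e, by linarith, ⟨?_, n + 1, fun k => if k ≤ n then t k else b + 1,
    ?_, by simp, by simp, ?_⟩, hec _ hab, ?_⟩
  · rw [← Icc_union_Icc_eq_Icc hab (by linarith : b ≤ b + 1)]
    exact (hcc.congr fun s hs => hec s hs.2).union_of_isClosed hγe.continuousOn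
      isClosed_Icc isClosed_Icc
  · refine monotone_nat_of_le_succ fun k => ?_
    by_cases h1 : k + 1 ≤ n
    · rw [if_pos h1, if_pos (by omega)]; exact ht k.le_succ
    · rw [if_neg h1]
      split_ifs with h2
      · have := ht h2
        show t k ≤ b + 1
        linarith
      · exact le_rfl
  · intro i hi
    by_cases h1 : i < n
    · simp only [if_pos h1.le, if_pos (Nat.succ_le_of_lt h1)]
      exact (hct i h1).congr fun s hs => hec s (hs.2.trans (ht (Nat.succ_le_of_lt h1)))
    · obtain rfl : i = n := by omega
      simpa using hγe
  · rw [heγ _ (by linarith)]; simp [γ]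

variable [IsManifold 𝓘(ℝ, X) 1 M]

namespace FinslerStructure

variable (F : FinslerStructure X M)

theorem continuous_chart_nrm {φ : OpenPartialHomeomorph M X}
    (hφ : φ ∈ IsManifold.maximalAtlas 𝓘(ℝ, X) 1 M) {u : X} (hu : u ∈ φ.target) :
    Continuous fun v : X => F.nrm (φ.symm u) (mfderiv 𝓘(ℝ, X) 𝓘(ℝ, X) φ.symm u v) := by
  obtain ⟨C, hC1, hC⟩ := F.exists_chart_bounds hφ hu
  lift C to NNReal using by linarith
  refine (LipschitzWith.of_le_add_mul C fun v w => ?_).continuous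
  have h1 : mfderiv 𝓘(ℝ, X) 𝓘(ℝ, X) φ.symm u v = mfderiv 𝓘(ℝ, X) 𝓘(ℝ, X) φ.symm u w +
      mfderiv 𝓘(ℝ, X) 𝓘(ℝ, X) φ.symm u (v - w) := by
    refine Eq.trans ?_ (map_add (mfderiv 𝓘(ℝ, X) 𝓘(ℝ, X) φ.symm u) w (v - w))
    exact congrArg _ (add_sub_cancel w v).symm
  rw [h1, dist_eq_norm]
  exact (F.add_le _ _ _).trans (add_le_add_right (hC _).2 _)

theorem nrm_mfderiv_symm_mfderiv {φ : OpenPartialHomeomorph M X}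
    (hφ : φ ∈ IsManifold.maximalAtlas 𝓘(ℝ, X) 1 M) {x : M} (hx : x ∈ φ.source)
    (w : TangentSpace 𝓘(ℝ, X) x) :
    F.nrm (φ.symm (φ x)) (mfderiv 𝓘(ℝ, X) 𝓘(ℝ, X) φ.symm (φ x)
      (mfderiv 𝓘(ℝ, X) 𝓘(ℝ, X) φ x w)) = F.nrm x w := by
  have h1 := DFunLike.congr_fun
    ((mdifferentiable_of_mem_maximalAtlas hφ).symm_comp_deriv hx) w
  have h2 : mfderiv 𝓘(ℝ, X) 𝓘(ℝ, X) φ.symm (φ x) (mfderiv 𝓘(ℝ, X) 𝓘(ℝ, X) φ x w) = w := h1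
  rw [h2]
  have h3 : ∀ y : M, y = x → F.nrm y (show X from w) = F.nrm x w := by rintro _ rfl; rfl
  exact h3 _ (φ.left_inv hx)

/-- The local consequence of the bound `K` for the subdifferentials: `f` is almost `K`-Lipschitz
near each point, for the norm of the tangent space at the point read in any chart. -/
def IsInfinitesimallyLipschitz (K : ℝ) (f : M → ℝ) : Prop :=
  ∀ φ ∈ IsManifold.maximalAtlas 𝓘(ℝ, X) 1 M, ∀ u ∈ φ.target, ∀ ε : ℝ, 0 < ε →
    ∀ᶠ y in 𝓝 u, |f (φ.symm y) - f (φ.symm u)| ≤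
      K * (1 + ε) * F.nrm (φ.symm u) (mfderiv 𝓘(ℝ, X) 𝓘(ℝ, X) φ.symm u (y - u))

variable {F} {K : ℝ} {f : M → ℝ}

theorem IsInfinitesimallyLipschitz.continuous (h : F.IsInfinitesimallyLipschitz K f) :
    Continuous f := by
  refine continuous_iff_continuousAt.2 fun x => ?_
  have hφ := IsManifold.chart_mem_maximalAtlas (I := 𝓘(ℝ, X)) (n := 1) x
  have hx := mem_chart_source X x
  set φ := chartAt X x
  have hu : φ x ∈ φ.target := φ.map_source hx
  have hc : Tendsto (fun y : X => K * (1 + 1) * F.nrm (φ.symm (φ x))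
      (mfderiv 𝓘(ℝ, X) 𝓘(ℝ, X) φ.symm (φ x) (y - φ x))) (𝓝 (φ x)) (𝓝 0) := by
    have := (((F.continuous_chart_nrm hφ hu).comp (continuous_id.sub continuous_const)).const_mul
      (K * (1 + 1))).tendsto (φ x) (f := fun y : X => K * (1 + 1) * F.nrm (φ.symm (φ x))
      (mfderiv 𝓘(ℝ, X) 𝓘(ℝ, X) φ.symm (φ x) (y - φ x)))
    have h0 : mfderiv 𝓘(ℝ, X) 𝓘(ℝ, X) φ.symm (φ x) (φ x - φ x) = 0 := by
      rw [sub_self]; exact map_zero _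
    rwa [h0, F.nrm_zero, mul_zero] at this
  have h1 : Tendsto (fun y => f (φ.symm y)) (𝓝 (φ x)) (𝓝 (f (φ.symm (φ x)))) :=
    tendsto_iff_dist_tendsto_zero.2
      (squeeze_zero' (.of_forall fun _ => dist_nonneg) (h φ hφ _ hu 1 one_pos) hc)
  rw [φ.left_inv hx] at h1
  refine (h1.comp (φ.continuousAt hx)).congr' ?_
  filter_upwards [φ.open_source.mem_nhds hx] with y hy
  rw [Function.comp_apply, φ.left_inv hy]

/-- In a chart the slopes of the path tend to its velocity. Continuity and homogeneity of the norm
at `c t` turn the local estimate into a slope bound, with `ε` absorbed by the strict inequality in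
`hr`. -/
theorem IsInfinitesimallyLipschitz.eventually_abs_lt
    (h : F.IsInfinitesimallyLipschitz K f) {c : ℝ → M} {a b : ℝ}
    (hc : ContMDiffOn 𝓘(ℝ, ℝ) 𝓘(ℝ, X) 1 c (Icc a b)) {t : ℝ} (ht : t ∈ Ico a b) {r : ℝ}
    (hr : K * F.nrm (c t) (mfderivWithin 𝓘(ℝ, ℝ) 𝓘(ℝ, X) c (Icc a b) t (1 : ℝ)) < r) :
    ∀ᶠ z in 𝓝[>] t, |f (c z) - f (c t)| < r * (z - t) := by
  have hφ := IsManifold.chart_mem_maximalAtlas (I := 𝓘(ℝ, X)) (n := 1) (c t)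
  have hx := mem_chart_source X (c t)
  set φ := chartAt X (c t)
  have hu : φ (c t) ∈ φ.target := φ.map_source hx
  have htI := Ico_subset_Icc_self ht
  set w := mfderivWithin 𝓘(ℝ, ℝ) 𝓘(ℝ, X) c (Icc a b) t (1 : ℝ) with hw
  rw [← F.nrm_mfderiv_symm_mfderiv hφ hx] at hr
  set v : X := mfderiv 𝓘(ℝ, X) 𝓘(ℝ, X) φ (c t) w with hv
  set N : X → ℝ := fun v => F.nrm (φ.symm (φ (c t)))
    (mfderiv 𝓘(ℝ, X) 𝓘(ℝ, X) φ.symm (φ (c t)) v) with hN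
  have hNc : Continuous N := F.continuous_chart_nrm hφ hu
  have hNs : ∀ (s : ℝ) (y : X), N (s • y) = |s| * N y := fun s y => by
    refine Eq.trans ?_ (F.smul _ s _)
    exact congrArg _ (map_smul (mfderiv 𝓘(ℝ, X) 𝓘(ℝ, X) φ.symm (φ (c t))) s y)
  have hder : HasDerivWithinAt (φ ∘ c) v (Icc a b) t := by
    have h1 := ((mdifferentiable_of_mem_maximalAtlas hφ).mdifferentiableAt hx).hasMFDerivAt
    have h2 := ((hc t htI).mdifferentiableWithinAt (by norm_num)).hasMFDerivWithinAt
    let L : ℝ →L[ℝ] X := (mfderiv 𝓘(ℝ, X) 𝓘(ℝ, X) φ (c t)).comp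
      (mfderivWithin 𝓘(ℝ, ℝ) 𝓘(ℝ, X) c (Icc a b) t)
    have h3 : HasFDerivWithinAt (φ ∘ c) L (Icc a b) t :=
      (h1.comp_hasMFDerivWithinAt t h2).hasFDerivWithinAt
    exact h3.hasDerivWithinAt
  have hIoo : 𝓝[Ioo t b] t = 𝓝[>] t := nhdsWithin_Ioo_eq_nhdsGT ht.2
  have hslope : Tendsto (slope (φ ∘ c) t) (𝓝[>] t) (𝓝 v) := by
    have := (hasDerivWithinAt_iff_tendsto_slope' (s := Ioo t b) (by simp)).1
      (hder.mono (Ioo_subset_Icc_self.trans (Icc_subset_Icc_left ht.1)))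
    rwa [hIoo] at this
  obtain ⟨ε, hε1, hε⟩ : ∃ ε : ℝ, K * (1 + ε) * N v < r ∧ 0 < ε := by
    have hcont : Continuous fun ε : ℝ => K * (1 + ε) * N v := by fun_prop
    have h1 : ∀ᶠ ε in 𝓝 (0 : ℝ), K * (1 + ε) * N v < r :=
      hcont.continuousAt.eventually_lt_const (by simpa using hr)
    exact ((h1.filter_mono nhdsWithin_le_nhds).and self_mem_nhdsWithin
      (f := 𝓝[>] (0 : ℝ))).exists
  have hct : Tendsto c (𝓝[>] t) (𝓝 (c t)) := by
    rw [← hIoo]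
    exact (hc.continuousOn t htI).mono_left
      (nhdsWithin_mono _ (Ioo_subset_Icc_self.trans (Icc_subset_Icc_left ht.1)))
  have h1 := (((hNc.tendsto v).comp hslope).const_mul (K * (1 + ε))).eventually_lt_const hε1
  have h2 := ((φ.continuousAt hx).tendsto.comp hct).eventually (h φ hφ _ hu ε hε)
  have h3 := hct.eventually (φ.open_source.mem_nhds hx)
  filter_upwards [h1, h2, h3, self_mem_nhdsWithin] with z h1 h2 h3 hz
  have hzt : 0 < z - t := sub_pos.2 hz
  have h5 : |f (φ.symm (φ (c z))) - f (φ.symm (φ (c t)))| ≤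
      K * (1 + ε) * N (φ (c z) - φ (c t)) := h2
  have h6 : f (φ.symm (φ (c z))) = f (c z) := by rw [φ.left_inv h3]
  have h7 : f (φ.symm (φ (c t))) = f (c t) := by rw [φ.left_inv hx]
  rw [h6, h7] at h5
  have h4 : N (φ (c z) - φ (c t)) = (z - t) * N (slope (φ ∘ c) t z) := by
    have := hNs (z - t) (slope (φ ∘ c) t z)
    rwa [abs_of_pos hzt, sub_smul_slope] at this
  calc _ ≤ K * (1 + ε) * N (φ (c z) - φ (c t)) := h5
    _ = K * (1 + ε) * N (slope (φ ∘ c) t z) * (z - t) := by rw [h4]; ring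
    _ < _ := mul_lt_mul_of_pos_right h1 hzt

theorem continuousOn_nrm_mfderivWithin (F : FinslerStructure X M) {c : ℝ → M} {a b : ℝ}
    (hab : a < b) (hc : ContMDiffOn 𝓘(ℝ, ℝ) 𝓘(ℝ, X) 1 c (Icc a b)) :
    ContinuousOn (fun t => F.nrm (c t)
      (mfderivWithin 𝓘(ℝ, ℝ) 𝓘(ℝ, X) c (Icc a b) t (1 : ℝ))) (Icc a b) := by
  have h1 := hc.continuousOn_tangentMapWithin le_rfl (uniqueDiffOn_Icc hab).uniqueMDiffOn
  have h2 : Continuous fun t : ℝ => (⟨t, (1 : ℝ)⟩ : TangentBundle 𝓘(ℝ, ℝ) ℝ) :=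
    (tangentBundleModelSpaceHomeomorph 𝓘(ℝ, ℝ)).symm.continuous.comp
      (continuous_id.prodMk continuous_const : Continuous fun t : ℝ => ((t, 1) : ℝ × ℝ))
  exact F.continuous_nrm.comp_continuousOn (h1.comp h2.continuousOn fun t ht => ht)

theorem IsInfinitesimallyLipschitz.abs_sub_le_of_contMDiffOn
    (h : F.IsInfinitesimallyLipschitz K f) {c : ℝ → M} {a b : ℝ} (hab : a ≤ b)
    (hc : ContMDiffOn 𝓘(ℝ, ℝ) 𝓘(ℝ, X) 1 c (Icc a b)) :
    IntervalIntegrable (fun t => F.nrm (c t) (mfderiv 𝓘(ℝ, ℝ) 𝓘(ℝ, X) c t (1 : ℝ)))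
      MeasureTheory.volume a b ∧ |f (c b) - f (c a)| ≤ K * F.length c a b := by
  rcases hab.eq_or_lt with rfl | hlt
  · simp [length]
  have hn := F.continuousOn_nrm_mfderivWithin hlt hc
  -- The one-sided velocity is continuous up to the endpoints, while `length` uses the two-sided
  -- one; they may differ only at the endpoints.
  have heq : EqOn (fun t => F.nrm (c t)
      (mfderivWithin 𝓘(ℝ, ℝ) 𝓘(ℝ, X) c (Icc a b) t (1 : ℝ)))
      (fun t => F.nrm (c t) (mfderiv 𝓘(ℝ, ℝ) 𝓘(ℝ, X) c t (1 : ℝ))) (uIoo a b) := by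
    intro t ht
    rw [uIoo_of_lt hlt] at ht
    simp only [mfderivWithin_of_mem_nhds (Icc_mem_nhds ht.1 ht.2)]
  refine ⟨IntervalIntegrable.congr_uIoo ?_ heq, ?_⟩
  · exact ContinuousOn.intervalIntegrable (by rwa [uIcc_of_le hab])
  · rw [length, ← intervalIntegral.integral_congr_uIoo heq,
      ← intervalIntegral.integral_const_mul]
    exact abs_sub_le_integral (h := fun t => f (c t)) hab
      (h.continuous.comp_continuousOn hc.continuousOn) (hn.const_mul K)
      fun t ht r hr => h.eventually_abs_lt hc ht hr

theorem IsInfinitesimallyLipschitz.abs_sub_le_length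
    (h : F.IsInfinitesimallyLipschitz K f) {c : ℝ → M} {a b : ℝ} (hc : IsPiecewiseC1 X c a b) :
    |f (c b) - f (c a)| ≤ K * F.length c a b := by
  obtain ⟨-, n, t, ht, rfl, rfl, hct⟩ := hc
  -- Integrability is carried through the induction because additivity of the length depends on it.
  suffices H : ∀ k ≤ n, IntervalIntegrable
      (fun t => F.nrm (c t) (mfderiv 𝓘(ℝ, ℝ) 𝓘(ℝ, X) c t (1 : ℝ)))
      MeasureTheory.volume (t 0) (t k) ∧ |f (c (t k)) - f (c (t 0))| ≤
        K * F.length c (t 0) (t k) from (H n le_rfl).2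
  intro k
  induction k with
  | zero => simp [length]
  | succ k ih =>
    intro hk
    obtain ⟨h1, h2⟩ := ih (by omega)
    obtain ⟨h3, h4⟩ := h.abs_sub_le_of_contMDiffOn (ht k.le_succ) (hct k hk)
    refine ⟨h1.trans h3, ?_⟩
    have h5 : F.length c (t 0) (t (k + 1)) =
        F.length c (t 0) (t k) + F.length c (t k) (t (k + 1)) :=
      (intervalIntegral.integral_add_adjacent_intervals h1 h3).symm
    rw [h5, mul_add]
    have h6 := abs_sub_le (f (c (t (k + 1)))) (f (c (t k))) (f (c (t 0)))
    linarith

end FinslerStructure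

/-- Chart balls are convex, so being reachable from `p` is locally constant and the reachable set is
clopen. This keeps the infimum defining `dist` from being over the empty set. -/
theorem isPiecewiseC1Joined [ConnectedSpace M] (p q : M) : IsPiecewiseC1Joined X p q := by
  have hnhd : ∀ x : M, ∀ᶠ y in 𝓝 x, IsPiecewiseC1Joined X p y ↔ IsPiecewiseC1Joined X p x := by
    intro x
    obtain ⟨φ, hφ, u, hu, rfl⟩ := exists_chart_symm_eq (X := X) x
    obtain ⟨R, hR, hsub⟩ := Metric.mem_nhds_iff.1 (φ.open_target.mem_nhds hu)
    have hx := φ.map_target hu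
    have hcont : Tendsto φ (𝓝 (φ.symm u)) (𝓝 u) := by
      simpa only [ContinuousAt, φ.right_inv hu] using φ.continuousAt hx
    have huR := Metric.mem_ball_self (x := u) hR
    filter_upwards [φ.open_source.mem_nhds hx,
      hcont.eventually (Metric.ball_mem_nhds u hR)] with y hy hyR
    rw [← φ.left_inv hy]
    exact ⟨fun h => h.extend hφ (((convex_ball u R).segment_subset hyR huR).trans hsub),
      fun h => h.extend hφ (((convex_ball u R).segment_subset huR hyR).trans hsub)⟩
  have hclopen : IsClopen {x : M | IsPiecewiseC1Joined X p x} := by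
    refine ⟨isOpen_compl_iff.1 (isOpen_iff_mem_nhds.2 fun x hx => ?_),
      isOpen_iff_mem_nhds.2 fun x hx => ?_⟩
    · filter_upwards [hnhd x] with y hy using fun h => hx (hy.1 h)
    · filter_upwards [hnhd x] with y hy using hy.2 hx
  have h := hclopen.eq_univ ⟨p, IsPiecewiseC1Joined.refl p⟩
  exact h.ge (mem_univ q)

end Paths

end PalaisFinsler

theorem mainTheorem6 {X : Type*} [NormedAddCommGroup X] [NormedSpace ℝ X] [CompleteSpace X]
    (hX : PalaisFinsler.HasC1LipschitzBump X)
    {M : Type*} [TopologicalSpace M] [T2Space M] [ParacompactSpace M] [ConnectedSpace M]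
    [ChartedSpace X M] [IsManifold 𝓘(ℝ, X) 1 M]
    (F : PalaisFinsler.FinslerStructure X M)
    (f : M → ℝ) (hf : LowerSemicontinuous f) (K : ℝ)
    (hK : ∀ x : M, ∀ ξ ∈ PalaisFinsler.subdifferential X f x, F.dualNorm x ξ ≤ K) :
    F.IsLipschitz K f := by
  have hK0 : 0 ≤ K := F.nonneg_of_dualNorm_le hX hf hK
  have hloc : F.IsInfinitesimallyLipschitz K f := fun φ hφ u hu ε hε =>
    F.eventually_abs_sub_le hX hf hK hφ hu hε
  refine ⟨hK0, fun p q => ?_⟩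
  have hle : ∀ L, (∃ (a b : ℝ) (c : ℝ → M), a ≤ b ∧ PalaisFinsler.IsPiecewiseC1 X c a b ∧
      c a = p ∧ c b = q ∧ L = F.length c a b) → |f p - f q| ≤ K * L := by
    rintro _ ⟨a, b, c, -, hc, rfl, rfl, rfl⟩
    rw [abs_sub_comm]
    exact hloc.abs_sub_le_length hc
  obtain ⟨a, b, c, hab, hc, hca, hcb⟩ := PalaisFinsler.isPiecewiseC1Joined (X := X) p q
  have hmem : ∃ (a' b' : ℝ) (c' : ℝ → M), a' ≤ b' ∧ PalaisFinsler.IsPiecewiseC1 X c' a' b' ∧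
      c' a' = p ∧ c' b' = q ∧ F.length c a b = F.length c' a' b' :=
    ⟨a, b, c, hab, hc, hca, hcb, rfl⟩
  -- For `K = 0` a single path already gives `f p = f q`; otherwise dividing by `K` turns the
  -- estimate into a lower bound for all lengths.
  rcases hK0.eq_or_lt with rfl | hpos
  · simpa using hle _ hmem
  · rw [← div_le_iff₀' hpos]
    exact le_csInf ⟨_, hmem⟩ fun L hL => (div_le_iff₀' hpos).2 (hle L hL)
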